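/- Let $d\ge 0$ be an integer and let $A,B\subset\mathbb{R}^d$ be finite sets with $|A|=m$. Assume that $B$ is proper $d$-dimensional, that is, not contained in any affine hyperplane of $\mathbb{R}^d$, and that $A\subset\operatorname{conv}B$, the convex hull of $B$. For a positive integer $k$ let $kB=B+\dots+B$ ($k$ summands) denote the $k$-fold sumset. Then for every positive integer $k$, $$|A+kB|\ \ge\ m\binom{d+k}{k}-k\binom{d+k}{k+1}=\left(m-\frac{kd}{k+1}\right)\binom{d+k}{k}.$$ -/

import Mathlib

open scoped Pointwise

/-- An affine hyperplane: a level set of a nonzero linear functional. -/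
def IsAffineHyperplane {d : ℕ} (H : Set (EuclideanSpace ℝ (Fin d))) : Prop :=
  ∃ f : EuclideanSpace ℝ (Fin d) →ₗ[ℝ] ℝ, f ≠ 0 ∧ ∃ c : ℝ, H = {x | f x = c}

/-- A set in `ℝ^d` is proper `d`-dimensional if it is not contained in any affine hyperplane. -/
def IsProperDimensional {d : ℕ} (B : Set (EuclideanSpace ℝ (Fin d))) : Prop :=
  ∀ H : Set (EuclideanSpace ℝ (Fin d)), IsAffineHyperplane H → ¬ B ⊆ H

/-- The `k`-fold sumset `kB = B + ⋯ + B` (`k` summands; `{0}` for `k = 0`).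
This is not the dilation `{k b | b ∈ B}`. -/
def iteratedSumset {d : ℕ} (B : Set (EuclideanSpace ℝ (Fin d))) :
    ℕ → Set (EuclideanSpace ℝ (Fin d))
  | 0 => {0}
  | k + 1 => iteratedSumset B k + B

/-! Triangulate `conv B` regularly with vertices in `B`. A point of a cell has unique barycentric
weights, and lifting by the heights shows more: a nonnegative combination supported on some cell is
determined by its total weight and sum alone (`IsRegularCell.weights_unique`). So give each `a ∈ A`
a face `T a` of a cell containing it, and translate `a` by the `k`-fold sums of vertices of `T a`. A
coincidence of two sums forces equality of the vectors `l + N`, where `l` holds the weights of `a`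
and `N` the multiplicities.

If `a` is not a vertex, `l` is the fractional part of `l + N`, so `a` is recovered; `T a` can be a
whole cell, giving `(d+k).choose k` sums. Vertices have integral weights and could collide. To
prevent this the vertices are placed one at a time outside the current hull, and `T a` contains only
vertices placed no later than `a`: a collision puts each of two vertices in the other's face,
contradicting the order. A placed vertex still gets a full cell, except that among the first `d` the
one of rank `j` is only guaranteed `j + 1` vertices. This loss totals `k * (d+k).choose (k+1)`. -/

/-! ### Regular triangulations from generic heights -/

section Triangulation

open Finset Filter Topology

variable {E : Type*} [NormedAddCommGroup E] [NormedSpace ℝ E]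

/-- A weighted sum of the values of an affine function depends only on the total weight and on the
weighted sum of the points. -/
theorem AffineMap.sum_mul_apply (h : E →ᵃ[ℝ] ℝ) (V : Finset E) (α : E → ℝ) :
    ∑ v ∈ V, α v * h v = h.linear (∑ v ∈ V, α v • v) + (∑ v ∈ V, α v) * h 0 := by
  rw [map_sum, Finset.sum_mul, ← Finset.sum_add_distrib]
  refine Finset.sum_congr rfl fun v _ => ?_
  have hv : h v = h.linear v + h 0 := congrFun h.decomp v
  rw [hv, map_smul, smul_eq_mul, mul_add]

theorem AffineIndependent.eq_zero_of_finset_sum {σ : Finset E}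
    (hσ : AffineIndependent ℝ (Subtype.val : ↥(σ : Set E) → E)) {α : E → ℝ}
    (h₀ : ∑ v ∈ σ, α v = 0) (h₁ : ∑ v ∈ σ, α v • v = 0) : ∀ v ∈ σ, α v = 0 := by
  intro v hv
  refine affineIndependent_iff.1 hσ Finset.univ (fun e => α e) ?_ ?_ ⟨v, hv⟩ (Finset.mem_univ _)
  · rw [← h₀]; exact Finset.sum_coe_sort σ α
  · rw [← h₁]; exact Finset.sum_coe_sort σ (fun v => α v • v)

/-- The full-dimensional cells of the regular subdivision of `V` with heights `w`, restricted to
those that are simplices: vertex sets of simplices on which some affine function lying below `w`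
coincides with `w`. -/
structure IsRegularCell (V : Finset E) (w : E → ℝ) (σ : Finset E) : Prop where
  subset : σ ⊆ V
  affineIndependent : AffineIndependent ℝ (Subtype.val : ↥(σ : Set E) → E)
  affineSpan_eq_top : affineSpan ℝ (σ : Set E) = ⊤
  exists_certificate : ∃ h : E →ᵃ[ℝ] ℝ, (∀ v ∈ V, h v ≤ w v) ∧ ∀ v ∈ V, h v = w v ↔ v ∈ σ

theorem IsRegularCell.card_eq [FiniteDimensional ℝ E] {V : Finset E} {w : E → ℝ} {σ : Finset E}
    (hσ : IsRegularCell V w σ) : #σ = Module.finrank ℝ E + 1 := by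
  have h := hσ.affineIndependent.affineSpan_eq_top_iff_card_eq_finrank_add_one
  rw [Subtype.range_coe] at h
  simpa using h.1 hσ.affineSpan_eq_top

/-- The certificate has equal totals on both combinations, agrees with `w` on `σ` and is strictly
below `w` on the rest of `V`. Thus weights on `σ` minimise the lifted height, and a tie forbids
weight outside `σ`. -/
theorem IsRegularCell.sum_mul_le {V : Finset E} {w : E → ℝ} {σ : Finset E}
    (hσ : IsRegularCell V w σ) {α β : E → ℝ} (hα : ∀ v ∉ σ, α v = 0) (hβ₀ : ∀ v, 0 ≤ β v)
    (hmass : ∑ v ∈ V, α v = ∑ v ∈ V, β v) (hsum : ∑ v ∈ V, α v • v = ∑ v ∈ V, β v • v) :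
    ∑ v ∈ V, α v * w v ≤ ∑ v ∈ V, β v * w v ∧
      (∑ v ∈ V, α v * w v = ∑ v ∈ V, β v * w v → ∀ v ∈ V, v ∉ σ → β v = 0) := by
  obtain ⟨h, hle, heq⟩ := hσ.exists_certificate
  have h1 : ∑ v ∈ V, α v * w v = ∑ v ∈ V, β v * h v := by
    rw [h.sum_mul_apply, ← hmass, ← hsum, ← h.sum_mul_apply]
    refine Finset.sum_congr rfl fun v hv => ?_
    by_cases hvσ : v ∈ σ
    · rw [(heq v hv).2 hvσ]
    · simp [hα v hvσ]
  have h2 : ∀ v ∈ V, β v * h v ≤ β v * w v := fun v hv =>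
    mul_le_mul_of_nonneg_left (hle v hv) (hβ₀ v)
  rw [h1]
  refine ⟨Finset.sum_le_sum h2, fun h3 v hv hvσ => ?_⟩
  have h4 := (Finset.sum_eq_sum_iff_of_le h2).1 h3 v hv
  by_contra h5
  exact hvσ ((heq v hv).1 (mul_left_cancel₀ h5 h4))

/-- Nonnegative combinations of the points of a cell are determined by their total weight and their
sum, even if the cell is not specified. -/
theorem IsRegularCell.weights_unique {V : Finset E} {w : E → ℝ} {σ τ : Finset E}
    (hσ : IsRegularCell V w σ) (hτ : IsRegularCell V w τ) {α β : E → ℝ}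
    (hα₀ : ∀ v, 0 ≤ α v) (hβ₀ : ∀ v, 0 ≤ β v)
    (hα : ∀ v ∉ σ, α v = 0) (hβ : ∀ v ∉ τ, β v = 0)
    (hmass : ∑ v ∈ V, α v = ∑ v ∈ V, β v) (hsum : ∑ v ∈ V, α v • v = ∑ v ∈ V, β v • v) :
    α = β := by
  have h1 := hσ.sum_mul_le hα hβ₀ hmass hsum
  have h2 := hτ.sum_mul_le hβ hα₀ hmass.symm hsum.symm
  have hβσ := h1.2 (le_antisymm h1.1 h2.1)
  have hβσ' : ∀ v ∉ σ, β v = 0 := fun v hv => by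
    by_cases hvV : v ∈ V
    · exact hβσ v hvV hv
    · exact hβ v fun h => hvV (hτ.subset h)
  have key := hσ.affineIndependent.eq_zero_of_finset_sum (α := α - β) ?_ ?_
  · funext v
    by_cases hv : v ∈ σ
    · exact sub_eq_zero.1 (key v hv)
    · rw [hα v hv, hβσ' v hv]
  · rw [Finset.sum_subset hσ.subset fun v _ hv => by simp [hα v hv, hβσ' v hv]]
    simp [Finset.sum_sub_distrib, hmass]
  · rw [Finset.sum_subset hσ.subset fun v _ hv => by simp [hα v hv, hβσ' v hv]]
    simp [Finset.sum_sub_distrib, sub_smul, hsum]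

/-- Heights for which the affine dependences of `V` do not lift. -/
def IsGenericHeight (V : Finset E) (w : E → ℝ) : Prop :=
  ∀ h : E →ᵃ[ℝ] ℝ, AffineIndependent ℝ (Subtype.val : {v | v ∈ V ∧ h v = w v} → E)

/-- At an interior point, the maximum of an affine function below the heights is attained. -/
theorem exists_affineMap_isMax [FiniteDimensional ℝ E] (V : Finset E) (w : E → ℝ) {x : E}
    (hx : x ∈ interior (convexHull ℝ (V : Set E))) :
    ∃ h : E →ᵃ[ℝ] ℝ, (∀ v ∈ V, h v ≤ w v) ∧
      ∀ g : E →ᵃ[ℝ] ℝ, (∀ v ∈ V, g v ≤ w v) → g x ≤ h x := by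
  obtain ⟨ε, hε, hball⟩ := Metric.isOpen_iff.1 isOpen_interior x hx
  replace hball := hball.trans interior_subset
  obtain ⟨c₀, hc₀⟩ : ∃ c₀ : ℝ, ∀ v ∈ V, c₀ ≤ w v := by
    obtain ⟨c, hc⟩ := (V.image w).bddBelow
    exact ⟨c, fun v hv => hc (Finset.mem_coe.2 (Finset.mem_image_of_mem w hv))⟩
  obtain ⟨C, hC⟩ : ∃ C : ℝ, ∀ v ∈ V, w v ≤ C := by
    obtain ⟨c, hc⟩ := (V.image w).bddAbove
    exact ⟨c, fun v hv => hc (Finset.mem_coe.2 (Finset.mem_image_of_mem w hv))⟩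
  -- Affine functions are parametrised by their value at `x` and their slope. The feasible ones with
  -- value at least `c₀` form a compact set: being at most `C` on a ball around `x` bounds the
  -- slope.
  let aff : ℝ × (E →L[ℝ] ℝ) → E →ᵃ[ℝ] ℝ := fun p =>
    p.2.toLinearMap.toAffineMap + AffineMap.const ℝ E (p.1 - p.2 x)
  have haff : ∀ p y, aff p y = p.1 + p.2 (y - x) := fun p y => by
    simp [aff]; ring
  have hbound : ∀ p, (∀ v ∈ V, aff p v ≤ w v) → ∀ y ∈ Metric.ball x ε, aff p y ≤ C := by
    intro p hp y hy
    have hconv : Convex ℝ {z | aff p z ≤ C} := by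
      have := (convex_Iic C).affine_preimage (aff p)
      simpa [Set.preimage] using this
    exact convexHull_min (fun v hv => (hp v hv).trans (hC v hv)) hconv (hball hy)
  let K : Set (ℝ × (E →L[ℝ] ℝ)) := {p | c₀ ≤ p.1 ∧ ∀ v ∈ V, p.1 + p.2 (v - x) ≤ w v}
  have hKclosed : IsClosed K := by
    have : K = {p | c₀ ≤ p.1} ∩ ⋂ v ∈ V, {p | p.1 + p.2 (v - x) ≤ w v} := by
      ext p; simp [K]
    rw [this]
    refine (isClosed_le continuous_const continuous_fst).inter
      (isClosed_biInter fun v _ => isClosed_le ?_ continuous_const)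
    fun_prop
  have hKbdd : Bornology.IsBounded K := by
    have hsub : K ⊆ Set.Icc c₀ C ×ˢ Metric.closedBall 0 (2 * (C - c₀) / ε) := by
      rintro p ⟨hp1, hp2⟩
      have hb := hbound p (fun v hv => by rw [haff]; exact hp2 v hv)
      have hpC : p.1 ≤ C := by
        have := hb x (Metric.mem_ball_self hε)
        simpa [haff] using this
      refine ⟨⟨hp1, hpC⟩, ?_⟩
      rw [mem_closedBall_zero_iff]
      have hCc : 0 ≤ C - c₀ := by linarith
      have hhalf : ∀ u : E, ‖u‖ < ε → p.2 u ≤ C - c₀ := fun u hu => by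
        have := hb (x + u) (by simpa using hu)
        rw [haff] at this
        simp only [add_sub_cancel_left] at this
        linarith
      refine ContinuousLinearMap.opNorm_le_of_shell hε (by positivity) (c := (2 : ℝ))
        (by norm_num) fun u hu hu' => ?_
      have h1 := hhalf u hu'
      have h2 := hhalf (-u) (by simpa using hu')
      rw [map_neg] at h2
      have h3 : ‖p.2 u‖ ≤ C - c₀ := by
        rw [Real.norm_eq_abs, abs_le]; constructor <;> linarith
      refine h3.trans ?_
      rw [Real.norm_ofNat] at hu
      rw [div_mul_eq_mul_div, le_div_iff₀ hε]
      nlinarith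
    exact ((Metric.isBounded_Icc c₀ C).prod Metric.isBounded_closedBall).subset hsub
  have : ProperSpace (ℝ × (E →L[ℝ] ℝ)) := FiniteDimensional.proper ℝ _
  have hKc : IsCompact K := Metric.isCompact_of_isClosed_isBounded hKclosed hKbdd
  have hKne : K.Nonempty := ⟨(c₀, 0), le_rfl, fun v hv => by simpa using hc₀ v hv⟩
  obtain ⟨p, hpK, hpmax⟩ := hKc.exists_isMaxOn hKne continuous_fst.continuousOn
  refine ⟨aff p, fun v hv => by rw [haff]; exact hpK.2 v hv, fun g hg => ?_⟩
  have hpx : aff p x = p.1 := by simp [haff]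
  rw [hpx]
  by_cases hgc : c₀ ≤ g x
  · refine hpmax (a := (g x, LinearMap.toContinuousLinearMap g.linear)) ⟨hgc, fun v hv => ?_⟩
    have h1 : g v = g.linear (v - x) + g x := by
      have := g.map_vadd x (v - x)
      simpa using this
    have := hg v hv
    simp only [LinearMap.coe_toContinuousLinearMap']
    linarith
  · exact (not_le.1 hgc).le.trans hpK.1

/-- The contact set of an affine function below the heights that is maximal at `x` has `x` in its
convex hull. -/
theorem mem_convexHull_contact [FiniteDimensional ℝ E] {V : Finset E} {w : E → ℝ} {x : E}
    {h : E →ᵃ[ℝ] ℝ} (hle : ∀ v ∈ V, h v ≤ w v)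
    (hmax : ∀ g : E →ᵃ[ℝ] ℝ, (∀ v ∈ V, g v ≤ w v) → g x ≤ h x) :
    x ∈ convexHull ℝ {v | v ∈ V ∧ h v = w v} := by
  by_contra hx
  have hfin : {v | v ∈ V ∧ h v = w v}.Finite := V.finite_toSet.subset fun v hv => hv.1
  obtain ⟨f, u, hfx, hfu⟩ := geometric_hahn_banach_point_closed (convex_convexHull ℝ _)
    (hfin.isClosed_convexHull ℝ) hx
  -- `g` is positive at `x` and negative on the contact set, so `h + ε • g` stays feasible for small
  -- `ε > 0` and beats `h` at `x`.
  let g : E →ᵃ[ℝ] ℝ := AffineMap.const ℝ E u - f.toLinearMap.toAffineMap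
  have hg : ∀ y, g y = u - f y := fun y => by simp [g]
  have hev : ∀ᶠ ε : ℝ in 𝓝[>] 0, ∀ v ∈ V, h v + ε * g v ≤ w v := by
    rw [Filter.eventually_all_finset]
    intro v hv
    rcases (hle v hv).lt_or_eq with hlt | heq
    · have hc : Tendsto (fun ε : ℝ => h v + ε * g v) (𝓝[>] 0) (𝓝 (h v + 0 * g v)) :=
        (Continuous.tendsto (by fun_prop) 0).mono_left nhdsWithin_le_nhds
      rw [zero_mul, add_zero] at hc
      exact (hc.eventually_lt_const hlt).mono fun _ => le_of_lt
    · filter_upwards [self_mem_nhdsWithin] with ε hε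
      have hgv : g v < 0 := by
        rw [hg]
        linarith [hfu v (subset_convexHull ℝ _ ⟨hv, heq⟩)]
      have : ε * g v < 0 := mul_neg_of_pos_of_neg hε hgv
      linarith
  obtain ⟨ε, hεV, hε⟩ := (hev.and self_mem_nhdsWithin).exists
  have h1 := hmax (h + ε • g) fun v hv => by simpa using hεV v hv
  have h2 : 0 < ε * g x := mul_pos hε (by rw [hg]; linarith)
  simp only [AffineMap.coe_add, AffineMap.coe_smul, Pi.add_apply, Pi.smul_apply, smul_eq_mul] at h1
  linarith

/-- For generic heights, the cells cover the convex hull. -/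
theorem IsGenericHeight.exists_cell [FiniteDimensional ℝ E] {V : Finset E} {w : E → ℝ}
    (hw : IsGenericHeight V w) (hV : affineSpan ℝ (V : Set E) = ⊤) {x : E}
    (hx : x ∈ convexHull ℝ (V : Set E)) :
    ∃ σ, IsRegularCell V w σ ∧ x ∈ convexHull ℝ (σ : Set E) := by
  classical
  -- Off the finitely many proper affine spans of subsets of `V`, a contact set with the point in
  -- its hull must span, hence is a cell. Such points are dense, and a finite union of cells is
  -- closed.
  let thin : Set (Finset E) := {S | S ∈ V.powerset ∧ affineSpan ℝ (S : Set E) ≠ ⊤}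
  have hthin : thin.Finite := V.powerset.finite_toSet.subset fun S hS => hS.1
  let G : Set E := ⋂ S ∈ thin, ((affineSpan ℝ (S : Set E) : AffineSubspace ℝ E) : Set E)ᶜ
  have hG : Dense G := by
    refine dense_biInter_of_isOpen (fun S _ => ?_) hthin.countable fun S hS => ?_
    · exact (AffineSubspace.closed_of_finiteDimensional _).isOpen_compl
    · rw [← interior_eq_empty_iff_dense_compl]
      by_contra hne
      have h1 := isOpen_interior.affineSpan_eq_top (Set.nonempty_iff_ne_empty.2 hne)
      refine hS.2 (top_le_iff.1 ?_)
      rw [← h1, affineSpan_le]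
      exact interior_subset
  have hcov : interior (convexHull ℝ (V : Set E)) ∩ G ⊆
      ⋃ σ ∈ {σ | IsRegularCell V w σ}, convexHull ℝ (σ : Set E) := by
    rintro y ⟨hy, hyG⟩
    obtain ⟨h, hle, hmax⟩ := exists_affineMap_isMax V w hy
    have hyS := mem_convexHull_contact hle hmax
    have hS : ((V.filter fun v => h v = w v : Finset E) : Set E) = {v | v ∈ V ∧ h v = w v} := by
      ext; simp
    rw [Set.mem_iUnion₂]
    refine ⟨V.filter fun v => h v = w v, ⟨Finset.filter_subset _ _, ?_, ?_, h, hle, ?_⟩, ?_⟩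
    · rw [hS]; exact hw h
    · by_contra hne
      refine Set.mem_iInter₂.1 hyG (V.filter fun v => h v = w v)
        ⟨Finset.mem_powerset.2 (Finset.filter_subset _ _), hne⟩ ?_
      rw [hS]
      exact convexHull_subset_affineSpan _ hyS
    · intro v hv; simp [hv]
    · rw [hS]; exact hyS
  have hfin : {σ | IsRegularCell V w σ}.Finite :=
    V.powerset.finite_toSet.subset fun σ hσ => Finset.mem_coe.2 (Finset.mem_powerset.2 hσ.subset)
  have hclosed : IsClosed (⋃ σ ∈ {σ | IsRegularCell V w σ}, convexHull ℝ (σ : Set E)) :=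
    hfin.isClosed_biUnion fun σ _ => σ.finite_toSet.isClosed_convexHull ℝ
  have hxcl : x ∈ closure (interior (convexHull ℝ (V : Set E))) := by
    rw [(convex_convexHull ℝ _).closure_interior_eq_closure_of_nonempty_interior
      (interior_convexHull_nonempty_iff_affineSpan_eq_top.2 hV)]
    exact subset_closure hx
  have hxU := closure_minimal ((hG.open_subset_closure_inter isOpen_interior).trans
    (closure_minimal hcov hclosed)) hclosed hxcl
  simpa using hxU

end Triangulation

/-! ### Placing triangulations -/

section Placing

open Finset

variable {E : Type*} [NormedAddCommGroup E] [NormedSpace ℝ E]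

theorem AffineMap.apply_eq_of_mem_affineSpan {h g : E →ᵃ[ℝ] ℝ} {S : Set E}
    (hS : ∀ v ∈ S, h v = g v) {x : E} (hx : x ∈ affineSpan ℝ S) : h x = g x := by
  refine affineSpan_induction (p := fun y => h y = g y) hx hS fun c u v y hu hv hy => ?_
  have hlin : h.linear (u - v) = g.linear (u - v) := by
    have h1 := h.linearMap_vsub u v
    have h2 := g.linearMap_vsub u v
    simp only [vsub_eq_sub] at h1 h2
    rw [h1, h2, hu, hv]
  rw [h.map_vadd, g.map_vadd, map_smul, map_smul, vsub_eq_sub, hlin, hy]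

/-- The heights at a new point that destroy genericity form a finite set. -/
theorem IsGenericHeight.exists_finite_exceptional [DecidableEq E] {V : Finset E} {w : E → ℝ}
    (hw : IsGenericHeight V w) {b : E} (hb : b ∉ V) :
    ∃ F : Set ℝ, F.Finite ∧ ∀ c ∉ F, IsGenericHeight (insert b V) (Function.update w b c) := by
  -- If `b` lies in the span of `S`, the values on `S` fix the value at `b`, so each `S` excludes at
  -- most one height.
  refine ⟨⋃ S ∈ (V.powerset : Set (Finset E)), {c | b ∈ affineSpan ℝ (S : Set E) ∧
    ∃ h : E →ᵃ[ℝ] ℝ, (∀ v ∈ S, h v = w v) ∧ h b = c}, ?_, ?_⟩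
  · refine V.powerset.finite_toSet.biUnion fun S _ => Set.Subsingleton.finite ?_
    rintro c ⟨hbS, h, hh, rfl⟩ c' ⟨-, g, hg, rfl⟩
    exact AffineMap.apply_eq_of_mem_affineSpan (fun v hv => (hh v hv).trans (hg v hv).symm) hbS
  · intro c hc h
    by_cases hbc : h b = c
    · have hspan : b ∉ affineSpan ℝ {v | v ∈ V ∧ h v = w v} := fun hmem => by
        refine hc (Set.mem_iUnion₂.2 ⟨V.filter fun v => h v = w v, ?_, ?_, h, ?_, hbc⟩)
        · exact Finset.mem_coe.2 (Finset.mem_powerset.2 (Finset.filter_subset _ _))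
        · simpa using hmem
        · simp
      let i : {v | v ∈ insert b V ∧ h v = Function.update w b c v} :=
        ⟨b, Finset.mem_insert_self _ _, by simpa using hbc⟩
      have hmem : ∀ x : {v | v ∈ insert b V ∧ h v = Function.update w b c v}, x ≠ i →
          (x : E) ∈ {v | v ∈ V ∧ h v = w v} := by
        rintro ⟨x, hx, hx'⟩ hxi
        have hxb : x ≠ b := fun h => hxi (Subtype.ext h)
        rw [Function.update_of_ne hxb] at hx'
        exact ⟨Finset.mem_of_mem_insert_of_ne hx hxb, hx'⟩
      refine AffineIndependent.affineIndependent_of_notMem_span (i := i) ?_ ?_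
      · let f : {x // x ≠ i} ↪ {v | v ∈ V ∧ h v = w v} :=
          ⟨fun x => ⟨x.1.1, hmem x.1 x.2⟩, fun x y hxy =>
            Subtype.ext (Subtype.ext (Subtype.mk.inj hxy))⟩
        exact (hw h).comp_embedding f
      · refine fun hi => hspan (affineSpan_mono ℝ ?_ hi)
        rintro _ ⟨x, hx, rfl⟩
        exact hmem x hx
    · refine (hw h).mono ?_
      rintro v ⟨hv, hvw⟩
      have hvb : v ≠ b := by
        rintro rfl
        exact hbc (by simpa using hvw)
      rw [Function.update_of_ne hvb] at hvw
      exact ⟨Finset.mem_of_mem_insert_of_ne hv hvb, hvw⟩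

/-- Cells survive the insertion of a point with a large height. -/
theorem IsRegularCell.exists_bound_insert [DecidableEq E] {V : Finset E} {w : E → ℝ} {b : E}
    (hb : b ∉ V) :
    ∃ M : ℝ, ∀ c > M, ∀ σ, IsRegularCell V w σ →
      IsRegularCell (insert b V) (Function.update w b c) σ := by
  have hne : ∀ v ∈ V, v ≠ b := fun v hv hvb => hb (hvb ▸ hv)
  have hσ : ∀ σ, ∃ M : ℝ, ∀ c > M, IsRegularCell V w σ →
      IsRegularCell (insert b V) (Function.update w b c) σ := by
    intro σ
    by_cases hσ : IsRegularCell V w σ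
    · obtain ⟨h, hle, heq⟩ := hσ.exists_certificate
      refine ⟨h b, fun c hc _ => ⟨hσ.subset.trans (Finset.subset_insert _ _),
        hσ.affineIndependent, hσ.affineSpan_eq_top, h, fun v hv => ?_, fun v hv => ?_⟩⟩
      · rcases Finset.mem_insert.1 hv with rfl | hv
        · simpa using hc.le
        · simpa [Function.update_of_ne (hne v hv)] using hle v hv
      · rcases Finset.mem_insert.1 hv with rfl | hv
        · rw [Function.update_self]
          exact iff_of_false hc.ne fun h => hb (hσ.subset h)
        · simpa [Function.update_of_ne (hne v hv)] using heq v hv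
    · exact ⟨0, fun _ _ h => absurd h hσ⟩
  choose M hM using hσ
  obtain ⟨m, hm⟩ := (V.powerset.image M).bddAbove
  refine ⟨m, fun c hc σ h => hM σ c (lt_of_le_of_lt (hm ?_) hc) h⟩
  exact Finset.mem_coe.2 (Finset.mem_image_of_mem M (Finset.mem_powerset.2 h.subset))

/-- Data of a placing triangulation: heights `w`, the order `r` in which the points of `V` are
placed, and for every `v ∈ V` a face `τ v` of some cell whose last vertex is `v`; all these faces
are full-dimensional except for those of the first vertices. -/
structure IsPlacing (V : Finset E) (w : E → ℝ) (r : E → ℕ) (τ : E → Finset E) : Prop where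
  affineSpan_eq_top : affineSpan ℝ (V : Set E) = ⊤
  generic : IsGenericHeight V w
  injOn : Set.InjOn r V
  rank_lt : ∀ v ∈ V, r v < #V
  mem_face : ∀ v ∈ V, v ∈ τ v
  rank_le : ∀ v ∈ V, ∀ u ∈ τ v, r u ≤ r v
  exists_cell : ∀ v ∈ V, ∃ σ, IsRegularCell V w σ ∧ τ v ⊆ σ
  le_card : ∀ v ∈ V, min (r v) (Module.finrank ℝ E) + 1 ≤ #(τ v)

/-- With zero heights the simplex itself is a cell; the face of `v` consists of the vertices placed
up to `v`, of which there are `r v + 1`. -/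
theorem IsPlacing.exists_of_simplex {V : Finset E}
    (hV : AffineIndependent ℝ (Subtype.val : ↥(V : Set E) → E))
    (hspan : affineSpan ℝ (V : Set E) = ⊤) : ∃ w r τ, IsPlacing V w r τ := by
  classical
  let e := V.equivFin
  let r : E → ℕ := fun v => if hv : v ∈ V then (e ⟨v, hv⟩ : ℕ) else 0
  have hr : ∀ v (hv : v ∈ V), r v = e ⟨v, hv⟩ := fun v hv => dif_pos hv
  have hinj : Set.InjOn r V := fun u hu v hv huv => by
    rw [hr u hu, hr v hv] at huv
    exact congrArg Subtype.val (e.injective (Fin.ext huv))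
  have hcell : IsRegularCell V (0 : E → ℝ) V :=
    ⟨subset_rfl, hV, hspan, 0, fun _ _ => le_rfl, fun v hv => by simp [hv]⟩
  refine ⟨0, r, fun v => V.filter fun u => r u ≤ r v, hspan, ?_, hinj, ?_, ?_, ?_, ?_, ?_⟩
  · exact fun h => hV.mono fun v hv => hv.1
  · intro v hv
    rw [hr v hv]
    exact (e ⟨v, hv⟩).2
  · intro v hv
    simp [hv]
  · intro v hv u hu
    exact (Finset.mem_filter.1 hu).2
  · exact fun v hv => ⟨V, hcell, Finset.filter_subset _ _⟩
  · intro v hv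
    have hle : #(range (r v + 1)) ≤ #(V.filter fun u => r u ≤ r v) := by
      refine Finset.card_le_card_of_surjOn r fun j hj => ?_
      have hj' : j ≤ r v := Nat.lt_succ_iff.1 (Finset.mem_range.1 hj)
      have hjV : j < #V := hj'.trans_lt (by rw [hr v hv]; exact (e ⟨v, hv⟩).2)
      have hrj : r (e.symm ⟨j, hjV⟩) = j := by
        rw [hr _ (e.symm ⟨j, hjV⟩).2]
        simp
      exact ⟨e.symm ⟨j, hjV⟩, by simp [hrj, hj'], hrj⟩
    rw [Finset.card_range] at hle
    omega

/-- A large generic height at `b` keeps all old cells and their faces. The new last vertex takes as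
its face a full cell containing it. -/
theorem IsPlacing.exists_insert [FiniteDimensional ℝ E] [DecidableEq E] {V : Finset E} {w : E → ℝ}
    {r : E → ℕ} {τ : E → Finset E} (h : IsPlacing V w r τ) {b : E}
    (hb : b ∉ convexHull ℝ (V : Set E)) :
    ∃ w' r' τ', IsPlacing (insert b V) w' r' τ' := by
  have hbV : b ∉ V := fun hbV => hb (subset_convexHull ℝ _ hbV)
  have hne : ∀ v ∈ V, v ≠ b := fun v hv hvb => hbV (hvb ▸ hv)
  obtain ⟨F, hF, hgen⟩ := h.generic.exists_finite_exceptional hbV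
  obtain ⟨M, hM⟩ := IsRegularCell.exists_bound_insert (w := w) hbV
  obtain ⟨c, hcM, hcF⟩ := (Set.Ioi_infinite M).exists_notMem_finite hF
  have hspan : affineSpan ℝ ((insert b V : Finset E) : Set E) = ⊤ := by
    refine top_le_iff.1 (h.affineSpan_eq_top ▸ affineSpan_mono ℝ ?_)
    exact Finset.coe_subset.2 (Finset.subset_insert _ _)
  obtain ⟨σ, hσ, hbσ⟩ := (hgen c hcF).exists_cell hspan (x := b)
    (subset_convexHull ℝ _ (Finset.mem_coe.2 (Finset.mem_insert_self b V)))
  -- A cell avoiding `b` would have all its vertices in `V`, putting `b` in the hull of `V`.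
  have hbσ' : b ∈ σ := by
    by_contra hbn
    refine hb (convexHull_mono (fun v hv => ?_) hbσ)
    exact Finset.mem_of_mem_insert_of_ne (hσ.subset hv) fun hvb => hbn (hvb ▸ hv)
  have hcard : #(insert b V) = #V + 1 := Finset.card_insert_of_notMem hbV
  have hrle : ∀ u ∈ insert b V, Function.update r b #V u ≤ #V := by
    intro u hu
    by_cases hub : u = b
    · simp [hub]
    · rw [Function.update_of_ne hub]
      exact (h.rank_lt u (Finset.mem_of_mem_insert_of_ne hu hub)).le
  refine ⟨Function.update w b c, Function.update r b #V, Function.update τ b σ, hspan,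
    hgen c hcF, ?_, ?_, ?_, ?_, ?_, ?_⟩
  · rw [Finset.coe_insert, Set.injOn_insert (by exact_mod_cast hbV)]
    refine ⟨fun u hu v hv huv => ?_, ?_⟩
    · rw [Function.update_of_ne (hne u hu), Function.update_of_ne (hne v hv)] at huv
      exact h.injOn hu hv huv
    · rintro ⟨v, hv, hvb⟩
      rw [Function.update_of_ne (hne v hv), Function.update_self] at hvb
      exact (h.rank_lt v hv).ne hvb
  · intro v hv
    rw [hcard]
    exact Nat.lt_succ_of_le (hrle v hv)
  · intro v hv
    rcases Finset.mem_insert.1 hv with rfl | hv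
    · simpa using hbσ'
    · rw [Function.update_of_ne (hne v hv)]
      exact h.mem_face v hv
  · intro v hv u hu
    rcases Finset.mem_insert.1 hv with rfl | hv
    · rw [Function.update_self] at hu ⊢
      exact hrle u (hσ.subset hu)
    · rw [Function.update_of_ne (hne v hv)] at hu ⊢
      obtain ⟨ρ, hρ, hτρ⟩ := h.exists_cell v hv
      rw [Function.update_of_ne (hne u (hρ.subset (hτρ hu)))]
      exact h.rank_le v hv u hu
  · intro v hv
    rcases Finset.mem_insert.1 hv with rfl | hv
    · exact ⟨σ, hσ, by simp⟩
    · obtain ⟨ρ, hρ, hτρ⟩ := h.exists_cell v hv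
      exact ⟨ρ, hM c hcM ρ hρ, by rwa [Function.update_of_ne (hne v hv)]⟩
  · intro v hv
    rcases Finset.mem_insert.1 hv with rfl | hv
    · rw [Function.update_self, Function.update_self, hσ.card_eq]
      omega
    · rw [Function.update_of_ne (hne v hv), Function.update_of_ne (hne v hv)]
      exact h.le_card v hv

/-- A placeable subset of `B` of maximal cardinality has all of `B` in its hull, since a point
outside could be placed next. -/
theorem exists_isPlacing [FiniteDimensional ℝ E] {B : Set E} (hB : B.Finite)
    (hspan : affineSpan ℝ B = ⊤) :
    ∃ (V : Finset E) (w : E → ℝ) (r : E → ℕ) (τ : E → Finset E), (V : Set E) ⊆ B ∧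
      convexHull ℝ B ⊆ convexHull ℝ (V : Set E) ∧ IsPlacing V w r τ := by
  classical
  let P : Finset (Finset E) := hB.toFinset.powerset.filter fun V => ∃ w r τ, IsPlacing V w r τ
  have hP : ∀ V : Finset E, V ∈ P ↔ (V : Set E) ⊆ B ∧ ∃ w r τ, IsPlacing V w r τ := fun V => by
    simp only [P, Finset.mem_filter, Finset.mem_powerset, ← Finset.coe_subset, hB.coe_toFinset]
  have hne : P.Nonempty := by
    obtain ⟨t, htB, ht, hind⟩ := exists_affineIndependent ℝ E B
    lift t to Finset E using hB.subset htB
    exact ⟨t, (hP t).2 ⟨htB, IsPlacing.exists_of_simplex hind (ht.trans hspan)⟩⟩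
  obtain ⟨V, hVP, hmax⟩ := P.exists_max_image (fun V => #V) hne
  obtain ⟨hVB, w, r, τ, h⟩ := (hP V).1 hVP
  refine ⟨V, w, r, τ, hVB, convexHull_min (fun b hbB => ?_) (convex_convexHull ℝ _), h⟩
  by_contra hb
  have hbV : b ∉ V := fun hbV => hb (subset_convexHull ℝ _ hbV)
  have := hmax (insert b V) ((hP _).2 ⟨?_, h.exists_insert hb⟩)
  · rw [Finset.card_insert_of_notMem hbV] at this
    omega
  · rw [Finset.coe_insert]
    exact Set.insert_subset hbB hVB

/-- Every point of the hull is a convex combination of the points of a cell, either trivially or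
with all weights less than `1`. -/
theorem IsPlacing.exists_weights [FiniteDimensional ℝ E] {V : Finset E} {w : E → ℝ}
    {r : E → ℕ} {τ : E → Finset E} (h : IsPlacing V w r τ) [DecidableEq E] {a : E}
    (ha : a ∈ convexHull ℝ (V : Set E)) :
    ∃ (l : E → ℝ) (T σ : Finset E), IsRegularCell V w σ ∧ T ⊆ σ ∧ (∀ v, 0 ≤ l v) ∧
      (∀ v ∉ σ, l v = 0) ∧ ∑ v ∈ V, l v = 1 ∧ ∑ v ∈ V, l v • v = a ∧
      (a ∈ V → l = Pi.single a 1 ∧ T = τ a) ∧ (a ∉ V → (∀ v, l v < 1) ∧ T = σ) := by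
  by_cases haV : a ∈ V
  · obtain ⟨σ, hσ, hτσ⟩ := h.exists_cell a haV
    refine ⟨Pi.single a 1, τ a, σ, hσ, hτσ, fun v => ?_, fun v hv => ?_, ?_, ?_,
      fun _ => ⟨rfl, rfl⟩, fun h => absurd haV h⟩
    · by_cases hva : v = a
      · subst hva; simp
      · simp [hva]
    · have hva : v ≠ a := fun hva => hv (hva ▸ hτσ (h.mem_face a haV))
      simp [hva]
    · simp [Pi.single_apply, haV]
    · simp [Pi.single_apply, haV]
  · obtain ⟨σ, hσ, haσ⟩ := h.generic.exists_cell h.affineSpan_eq_top ha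
    obtain ⟨l, hl₀, hl₁, hla⟩ := Finset.mem_convexHull'.1 haσ
    have hoff : ∀ v ∈ V, v ∉ σ → (if v ∈ σ then l v else 0) = 0 := fun v _ hv => if_neg hv
    refine ⟨fun v => if v ∈ σ then l v else 0, σ, σ, hσ, subset_rfl, fun v => ?_,
      fun v hv => if_neg hv, ?_, ?_, fun h => absurd h haV, fun _ => ⟨fun v => ?_, rfl⟩⟩
    · dsimp only
      split_ifs with hv
      exacts [hl₀ v hv, le_rfl]
    · rw [← Finset.sum_subset hσ.subset hoff, ← hl₁]
      exact Finset.sum_congr rfl fun v hv => if_pos hv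
    · rw [← Finset.sum_subset hσ.subset fun v hv hvσ => by simp [hvσ], ← hla]
      exact Finset.sum_congr rfl fun v hv => by simp only [if_pos hv]
    · dsimp only
      split_ifs with hv
      · by_contra! hlv
        have hle : l v ≤ 1 := hl₁ ▸ Finset.single_le_sum hl₀ hv
        have hzero : ∀ u ∈ σ.erase v, l u = 0 := by
          have hsum : ∑ u ∈ σ.erase v, l u = 0 := by
            have := Finset.add_sum_erase σ l hv
            linarith
          exact (Finset.sum_eq_zero_iff_of_nonneg
            fun u hu => hl₀ u (Finset.mem_of_mem_erase hu)).1 hsum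
        refine haV ?_
        rw [← hla, ← Finset.add_sum_erase σ _ hv,
          Finset.sum_eq_zero fun u hu => by rw [hzero u hu, zero_smul],
          le_antisymm hle hlv, one_smul, add_zero]
        exact hσ.subset hv
      · exact zero_lt_one

end Placing

/-! ### Counting distinct sums -/

section Counting

open Finset

/-- Weights in `[0, 1)` are determined by their sum with natural multiplicities. -/
theorem weights_eq_of_add_natCast_eq {ι : Type*} {l l' : ι → ℝ}
    (hl : ∀ v, 0 ≤ l v) (hl' : ∀ v, 0 ≤ l' v)
    (hlt : ∀ v, l v < 1) (hlt' : ∀ v, l' v < 1) {N N' : ι → ℕ}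
    (h : ∀ v, l v + N v = l' v + N' v) : l = l' := by
  funext v
  have := congrArg Int.fract (h v)
  rwa [Int.fract_add_natCast, Int.fract_add_natCast, Int.fract_eq_self.2 ⟨hl v, hlt v⟩,
    Int.fract_eq_self.2 ⟨hl' v, hlt' v⟩] at this

theorem weights_eq_zero_of_add_natCast_eq_single {ι : Type*} [DecidableEq ι] {l : ι → ℝ}
    (hl : ∀ v, 0 ≤ l v)
    (hlt : ∀ v, l v < 1) {N N' : ι → ℕ} {a : ι}
    (h : ∀ v, l v + N v = (Pi.single a 1 : ι → ℝ) v + N' v) : l = 0 :=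
  -- The unit weight at `a` is absorbed into the multiplicities, leaving fractional part zero.
  weights_eq_of_add_natCast_eq (N := N) (N' := fun v => (Pi.single a 1 : ι → ℕ) v + N' v) hl
    (fun _ => le_rfl) hlt (fun _ => zero_lt_one) fun v => by
      rw [h v]
      by_cases hva : v = a
      · subst hva; simp
      · simp [hva]

variable {E : Type*} [NormedAddCommGroup E] [NormedSpace ℝ E]

/-- Lower bound for the number of distinct sums of a point of `A` and `k` points of `V`, not
necessarily distinct. -/
theorem IsPlacing.card_mul_choose_le [FiniteDimensional ℝ E] {V : Finset E} {w : E → ℝ}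
    {r : E → ℕ} {τ : E → Finset E} (h : IsPlacing V w r τ) {A S : Finset E} {k : ℕ}
    (hA : (A : Set E) ⊆ convexHull ℝ (V : Set E))
    (hS : ∀ a ∈ A, ∀ N : E → ℕ, ∑ v ∈ V, N v = k → a + ∑ v ∈ V, N v • v ∈ S) :
    #A * (Module.finrank ℝ E + k).choose k ≤ #S +
      ∑ j ∈ range (Module.finrank ℝ E),
        ((Module.finrank ℝ E + k).choose k - (j + k).choose k) := by
  classical
  set d := Module.finrank ℝ E with hd
  have hex := fun a : A => h.exists_weights (hA a.2)
  choose l T σ hσ hT hl₀ hlσ hl₁ hla hvert hnon using hex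
  have hTV : ∀ a, T a ⊆ V := fun a => (hT a).trans (hσ a).subset
  have hN : ∀ a, ∀ N ∈ (T a).finsuppAntidiag k, (∀ v ∉ T a, N v = 0) ∧ ∑ v ∈ V, N v = k := by
    intro a N hN
    rw [Finset.mem_finsuppAntidiag] at hN
    have hz : ∀ v ∉ T a, N v = 0 := fun v hv => by
      by_contra hne
      exact hv (hN.2 (Finsupp.mem_support_iff.2 hne))
    exact ⟨hz, by rw [← Finset.sum_subset (hTV a) fun v _ hv => hz v hv]; exact hN.1⟩
  have hinj : Set.InjOn (fun p : (_ : A) × (E →₀ ℕ) => (p.1 : E) + ∑ v ∈ V, p.2 v • v)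
      ((Finset.univ : Finset A).sigma fun a => (T a).finsuppAntidiag k) := by
    rintro ⟨a, N⟩ hp ⟨a', N'⟩ hp' heq
    obtain ⟨hNz, hNk⟩ := hN a N (Finset.mem_sigma.1 hp).2
    obtain ⟨hNz', hNk'⟩ := hN a' N' (Finset.mem_sigma.1 hp').2
    have hfun : (fun v => l a v + N v) = fun v => l a' v + N' v := by
      refine (hσ a).weights_unique (hσ a') (fun v => by have := hl₀ a v; positivity)
        (fun v => by have := hl₀ a' v; positivity) (fun v hv => ?_) (fun v hv => ?_) ?_ ?_
      · simp [hlσ a v hv, hNz v fun hvT => hv (hT a hvT)]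
      · simp [hlσ a' v hv, hNz' v fun hvT => hv (hT a' hvT)]
      · rw [Finset.sum_add_distrib, Finset.sum_add_distrib, hl₁, hl₁, ← Nat.cast_sum,
          ← Nat.cast_sum, hNk, hNk']
      · simp only [add_smul, Finset.sum_add_distrib, hla, Nat.cast_smul_eq_nsmul]
        exact heq
    have hpt : ∀ v, l a v + N v = l a' v + N' v := congrFun hfun
    have hone : ∀ a, l a ≠ 0 := fun a h0 => by
      have := hl₁ a
      simp [h0] at this
    have haa : a = a' := by
      by_cases haV : (a : E) ∈ V
      · by_cases haV' : (a' : E) ∈ V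
        · obtain ⟨hla1, hTa⟩ := hvert a haV
          obtain ⟨hla1', hTa'⟩ := hvert a' haV'
          by_contra hne
          have hne' : (a : E) ≠ a' := fun h => hne (Subtype.ext h)
          -- At coordinate `a'` the equality reads `N a' = 1 + N' a'`, so `N a'` is nonzero.
          have hmem : (a' : E) ∈ T a := by
            by_contra hmem
            have h1 := hpt a'
            rw [hla1, hla1', hNz _ hmem, Pi.single_eq_of_ne hne'.symm, Pi.single_eq_same] at h1
            have : (0 : ℝ) ≤ N' a' := Nat.cast_nonneg _
            push_cast at h1
            linarith
          have hmem' : (a : E) ∈ T a' := by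
            by_contra hmem'
            have h1 := hpt a
            rw [hla1, hla1', hNz' _ hmem', Pi.single_eq_of_ne hne', Pi.single_eq_same] at h1
            have : (0 : ℝ) ≤ N a := Nat.cast_nonneg _
            push_cast at h1
            linarith
          rw [hTa] at hmem
          rw [hTa'] at hmem'
          exact hne' (h.injOn haV haV' (le_antisymm (h.rank_le _ haV' _ hmem')
            (h.rank_le _ haV _ hmem)))
        · refine absurd (weights_eq_zero_of_add_natCast_eq_single (hl₀ a') (hnon a' haV').1
            (N := N') (N' := N) (a := a) fun v => ?_) (hone a')
          rw [← (hvert a haV).1, hpt v]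
      · by_cases haV' : (a' : E) ∈ V
        · refine absurd (weights_eq_zero_of_add_natCast_eq_single (hl₀ a) (hnon a haV).1
            (N := N) (N' := N') (a := a') fun v => ?_) (hone a)
          rw [← (hvert a' haV').1, hpt v]
        · have hll := weights_eq_of_add_natCast_eq (hl₀ a) (hl₀ a') (hnon a haV).1
            (hnon a' haV').1 hpt
          exact Subtype.ext (by rw [← hla a, ← hla a', hll])
    subst haa
    have hNN : N = N' := Finsupp.ext fun v => by
      have := hpt v
      exact_mod_cast add_left_cancel this
    rw [hNN]
  have hcard := Finset.card_le_card_of_injOn _ (t := S) (fun p hp => by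
    obtain ⟨hNz, hNk⟩ := hN p.1 p.2 (Finset.mem_sigma.1 hp).2
    exact hS p.1 p.1.2 p.2 hNk) hinj
  rw [Finset.card_sigma] at hcard
  simp only [Finset.card_finsuppAntidiag_nat_eq_choose] at hcard
  -- Only vertices of rank below `d` can fall short of `(d+k).choose k` sums; distinct ranks bound
  -- the total shortfall by a sum over `j < d`.
  have hlow : ∀ a : A, (d + k).choose k ≤ (#(T a) + k - 1).choose k +
      if (a : E) ∈ V ∧ r a < d then (d + k).choose k - (r a + k).choose k else 0 := by
    intro a
    by_cases haV : (a : E) ∈ V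
    · have hle := h.le_card a haV
      rw [← (hvert a haV).2, ← hd] at hle
      by_cases hr : r a < d
      · rw [if_pos ⟨haV, hr⟩]
        have : (r a + k).choose k ≤ (#(T a) + k - 1).choose k :=
          Nat.choose_le_choose k (by omega)
        omega
      · rw [if_neg fun h => hr h.2, add_zero]
        exact Nat.choose_le_choose k (by omega)
    · rw [if_neg fun h => haV h.1, (hnon a haV).2, (hσ a).card_eq, ← hd, add_zero]
      exact Nat.choose_le_choose k (by omega)
  have hsum := Finset.sum_le_sum fun a (_ : a ∈ (Finset.univ : Finset A)) => hlow a
  rw [Finset.sum_const, Finset.card_univ, Fintype.card_coe, smul_eq_mul,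
    Finset.sum_add_distrib] at hsum
  refine hsum.trans (Nat.add_le_add hcard ?_)
  rw [Finset.sum_coe_sort A (fun a => if a ∈ V ∧ r a < d then
    (d + k).choose k - (r a + k).choose k else 0), ← Finset.sum_filter]
  have himg : Set.InjOn r (A.filter fun a => a ∈ V ∧ r a < d : Finset E) := fun u hu v hv huv =>
    h.injOn (Finset.mem_filter.1 hu).2.1 (Finset.mem_filter.1 hv).2.1 huv
  rw [← Finset.sum_image (f := fun j => (d + k).choose k - (j + k).choose k) himg]
  refine Finset.sum_le_sum_of_subset fun j hj => ?_
  obtain ⟨a, ha, rfl⟩ := Finset.mem_image.1 hj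
  exact Finset.mem_range.2 (Finset.mem_filter.1 ha).2.2

/-- The hockey-stick identity evaluates the subtracted terms as `(d+k).choose (k+1)`, and `d *
(d+k).choose k = (k+1) * (d+k).choose (k+1)`. No natural subtraction truncates, as `j < d`. -/
theorem sum_range_choose_sub (d k : ℕ) :
    ((∑ j ∈ range d, ((d + k).choose k - (j + k).choose k) : ℕ) : ℝ) =
      k * ((d + k).choose (k + 1) : ℝ) := by
  have h1 := Nat.sum_range_add_choose d k
  rw [Finset.sum_range_succ, Nat.choose_succ_succ'] at h1
  have h2 := Nat.choose_succ_right_eq (d + k) k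
  rw [Nat.add_sub_cancel] at h2
  have h3 : ((∑ j ∈ range d, (j + k).choose k : ℕ) : ℝ) = (d + k).choose (k + 1) := by
    norm_cast; omega
  have h4 : ((d + k).choose (k + 1) : ℝ) * (k + 1) = (d + k).choose k * d := by exact_mod_cast h2
  rw [Nat.cast_sum, Finset.sum_congr rfl fun j hj => Nat.cast_sub
    (Nat.choose_le_choose k (Nat.add_le_add_right (Finset.mem_range.1 hj).le k)),
    Finset.sum_sub_distrib, ← Nat.cast_sum (range d) fun j => (j + k).choose k, h3]
  simp only [Finset.sum_const, Finset.card_range, nsmul_eq_mul]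
  linarith

end Counting

/-! ### Iterated sumsets and proper dimension -/

section IteratedSumset

variable {d : ℕ} {B : Set (EuclideanSpace ℝ (Fin d))}

theorem iteratedSumset_finite (hB : B.Finite) : ∀ k, (iteratedSumset B k).Finite
  | 0 => Set.finite_singleton 0
  | k + 1 => (iteratedSumset_finite hB k).add hB

theorem add_mem_iteratedSumset {x : EuclideanSpace ℝ (Fin d)} {k : ℕ}
    (hx : x ∈ iteratedSumset B k) : ∀ {n : ℕ} {y}, y ∈ iteratedSumset B n →
      x + y ∈ iteratedSumset B (k + n)
  | 0, y, hy => by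
    obtain rfl : y = 0 := hy
    simpa using hx
  | n + 1, y, hy => by
    obtain ⟨z, hz, b, hb, rfl⟩ := Set.mem_add.1 hy
    rw [← add_assoc x]
    exact Set.add_mem_add (add_mem_iteratedSumset hx hz) hb

theorem nsmul_mem_iteratedSumset {b : EuclideanSpace ℝ (Fin d)} (hb : b ∈ B) :
    ∀ n : ℕ, n • b ∈ iteratedSumset B n
  | 0 => by rw [zero_smul]; exact Set.mem_singleton 0
  | n + 1 => by
    rw [succ_nsmul]
    exact Set.add_mem_add (nsmul_mem_iteratedSumset hb n) hb

theorem sum_nsmul_mem_iteratedSumset {V : Finset (EuclideanSpace ℝ (Fin d))}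
    (hV : (V : Set (EuclideanSpace ℝ (Fin d))) ⊆ B) (N : EuclideanSpace ℝ (Fin d) → ℕ) :
    ∑ v ∈ V, N v • v ∈ iteratedSumset B (∑ v ∈ V, N v) := by
  classical
  induction V using Finset.induction_on with
  | empty => exact Set.mem_singleton 0
  | insert b V hb ih =>
    rw [Finset.coe_insert, Set.insert_subset_iff] at hV
    rw [Finset.sum_insert hb, Finset.sum_insert hb]
    exact add_mem_iteratedSumset (nsmul_mem_iteratedSumset hV.1 _) (ih hV.2)

theorem IsProperDimensional.affineSpan_eq_top (hB : IsProperDimensional B) (hne : B.Nonempty) :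
    affineSpan ℝ B = ⊤ := by
  obtain ⟨p, hp⟩ := hne
  rw [AffineSubspace.affineSpan_eq_top_iff_vectorSpan_eq_top_of_nonempty ℝ _ _ ⟨p, hp⟩]
  by_contra hlt
  obtain ⟨f, hf, hker⟩ := (vectorSpan ℝ B).exists_le_ker_of_lt_top (lt_top_iff_ne_top.2 hlt)
  refine hB {x | f x = f p} ⟨f, hf, f p, rfl⟩ fun x hx => ?_
  have := hker (vsub_mem_vectorSpan ℝ hx hp)
  rw [LinearMap.mem_ker, vsub_eq_sub, map_sub, sub_eq_zero] at this
  exact this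

end IteratedSumset

theorem theorem4 (d m k : ℕ) (hk : 0 < k) (A B : Set (EuclideanSpace ℝ (Fin d)))
    (hA : A.Finite) (hB : B.Finite) (hm : A.ncard = m)
    (hBd : IsProperDimensional B) (hAB : A ⊆ convexHull ℝ B) :
    ((A + iteratedSumset B k).ncard : ℝ) ≥
        (m : ℝ) * ((d + k).choose k : ℝ) - (k : ℝ) * ((d + k).choose (k + 1) : ℝ) ∧
      (m : ℝ) * ((d + k).choose k : ℝ) - (k : ℝ) * ((d + k).choose (k + 1) : ℝ) =
        ((m : ℝ) - (k : ℝ) * (d : ℝ) / ((k : ℝ) + 1)) * ((d + k).choose k : ℝ) := by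
  constructor
  -- For `d = 0` there are no affine hyperplanes, so the empty set counts as proper; then `A` is
  -- empty and the bound is nonpositive.
  · rcases B.eq_empty_or_nonempty with rfl | hne
    · rw [convexHull_empty, Set.subset_empty_iff] at hAB
      subst hAB
      rw [Set.ncard_empty] at hm
      subst hm
      simp only [Set.empty_add, Set.ncard_empty, Nat.cast_zero, zero_mul, zero_sub, ge_iff_le,
        neg_nonpos]
      positivity
    · obtain ⟨V, w, r, τ, hVB, hconv, h⟩ := exists_isPlacing hB (hBd.affineSpan_eq_top hne)
      have hfin := hA.add (iteratedSumset_finite hB k)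
      have key := h.card_mul_choose_le (A := hA.toFinset) (S := hfin.toFinset) (k := k)
        (by rw [hA.coe_toFinset]; exact hAB.trans hconv) (fun a ha N hN => by
          rw [Set.Finite.mem_toFinset] at ha ⊢
          exact Set.add_mem_add ha (hN ▸ sum_nsmul_mem_iteratedSumset hVB N))
      rw [finrank_euclideanSpace_fin, ← Set.ncard_eq_toFinset_card A hA, hm,
        ← Set.ncard_eq_toFinset_card _ hfin] at key
      have key' : (m : ℝ) * (d + k).choose k ≤ (A + iteratedSumset B k).ncard +
          ((∑ j ∈ Finset.range d, ((d + k).choose k - (j + k).choose k) : ℕ) : ℝ) := by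
        exact_mod_cast key
      rw [sum_range_choose_sub] at key'
      linarith
  · have h2 := Nat.choose_succ_right_eq (d + k) k
    rw [Nat.add_sub_cancel] at h2
    have h4 : ((d + k).choose (k + 1) : ℝ) * (k + 1) = (d + k).choose k * d := by exact_mod_cast h2
    have hk' : (k : ℝ) + 1 ≠ 0 := by positivity
    field_simp
    linear_combination (-(k : ℝ)) * h4
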